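/- Let $d\in\mathbb N$, $\alpha>0$ and $T>0$. All functions are complex-valued unless said otherwise. For $s>0$ let $(-\Delta)^{s}$ be the operator in $L^2(\mathbb R^d)$ with Fourier symbol $|\xi|^{2s}$ (for the Fourier transform with kernel $e^{-i x\cdot\xi}$), let $H^\alpha(\mathbb R^d)=\{u\in L^2(\mathbb R^d): (-\Delta)^{\alpha/2}u\in L^2(\mathbb R^d)\}$ with the norm $\|u\|_{H^\alpha}=\|u\|_{L^2}+\|(-\Delta)^{\alpha/2}u\|_{L^2}$, and let $\langle\cdot,\cdot\rangle$ be the inner product of $L^2(\mathbb R^d)$. There is a constant $C>0$, depending only on $d$, $\alpha$ and $T$, such that the following holds. Let $m\in L^\infty(\mathbb R^d)$ be real-valued with $m\ge 0$ almost everywhere, let $u_0\in H^\alpha(\mathbb R^d)$ and let $u_1\in L^2(\mathbb R^d)$. Then the Cauchy problem $$u_{tt}+(-\Delta)^\alpha u+m\,u=0 \ \text{ on } [0,T]\times\mathbb R^d,\qquad u(0)=u_0,\quad u_t(0)=u_1,$$ has a unique solution $u\in C([0,T];H^\alpha(\mathbb R^d))\cap C^1([0,T];L^2(\mathbb R^d))$,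 where the equation is understood in the dual space of $H^\alpha(\mathbb R^d)$, that is, for every $\varphi\in H^\alpha(\mathbb R^d)$ the function $t\mapsto\langle u_t(t),\varphi\rangle$ is differentiable on $[0,T]$ and $$\frac{d}{dt}\langle u_t(t),\varphi\rangle+\langle(-\Delta)^{\alpha/2}u(t),(-\Delta)^{\alpha/2}\varphi\rangle+\langle m\,u(t),\varphi\rangle=0\qquad\text{for all } t\in[0,T].$$ Moreover, for all $t\in[0,T]$, $$\bigl(\|u(t)\|_{H^\alpha}+\|u_t(t)\|_{L^2}\bigr)^2\le C\,(1+\|m\|_{L^\infty})\bigl(\|u_1\|_{L^2}^2+\|u_0\|_{H^\alpha}^2\bigr).$$ -/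

import Mathlib

open MeasureTheory Set
open scoped FourierTransform ENNReal

noncomputable section

namespace FractionalKleinGordon

/-- Complex-valued `L²(ℝ^d)`. -/
abbrev L2 (d : ℕ) : Type := Lp (α := EuclideanSpace ℝ (Fin d)) ℂ 2 volume

/-- Real-valued `L^∞(ℝ^d)`. -/
abbrev LInfty (d : ℕ) : Type := Lp (α := EuclideanSpace ℝ (Fin d)) ℝ ∞ volume

/-- The symbol of `(-Δ)^s`. Mathlib's Fourier kernel is `exp (-2πi⟪x, ξ⟫)`, so the symbol of `-Δ`
is `(2π|ξ|)²`. -/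
def fracSymbol {d : ℕ} (s : ℝ) (ξ : EuclideanSpace ℝ (Fin d)) : ℂ :=
  (((2 * Real.pi * ‖ξ‖) ^ (2 * s) : ℝ) : ℂ)

/-- `ξ ↦ (2π|ξ|)^{2s} û(ξ)`, where `û` is the `L²` Fourier transform of `u`. -/
def fracFourier {d : ℕ} (s : ℝ) (u : L2 d) (ξ : EuclideanSpace ℝ (Fin d)) : ℂ :=
  fracSymbol s ξ * (𝓕 u : L2 d) ξ

lemma fracFourier_add {d : ℕ} (s : ℝ) (u v : L2 d) :
    fracFourier s (u + v) =ᵐ[volume] fracFourier s u + fracFourier s v := by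
  have h : (𝓕 (u + v) : L2 d) = 𝓕 u + 𝓕 v := FourierTransform.fourier_add u v
  filter_upwards [Lp.coeFn_add (𝓕 u : L2 d) (𝓕 v)] with ξ hξ
  simp only [fracFourier, h, hξ, Pi.add_apply, mul_add]

lemma fracFourier_smul {d : ℕ} (s : ℝ) (c : ℂ) (u : L2 d) :
    fracFourier s (c • u) =ᵐ[volume] c • fracFourier s u := by
  have h : (𝓕 (c • u) : L2 d) = c • 𝓕 u := FourierTransform.fourier_smul c u
  filter_upwards [Lp.coeFn_smul c (𝓕 u : L2 d)] with ξ hξ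
  simp only [fracFourier, h, hξ, Pi.smul_apply, smul_eq_mul]
  ring

/-- The domain of `(-Δ)^s` in `L²(ℝ^d)`. -/
def fracDomain (d : ℕ) (s : ℝ) : Submodule ℂ (L2 d) where
  carrier := {u | MemLp (fracFourier s u) 2 volume}
  add_mem' {u v} hu hv := (memLp_congr_ae (fracFourier_add s u v)).2 (MemLp.add hu hv)
  zero_mem' := by
    have h := fracFourier_smul s 0 (0 : L2 d)
    rw [zero_smul, zero_smul] at h
    exact (memLp_congr_ae h).2 MemLp.zero
  smul_mem' c u hu := (memLp_congr_ae (fracFourier_smul s c u)).2 (MemLp.const_smul hu c)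

lemma memLp_fracFourier {d : ℕ} {s : ℝ} (u : fracDomain d s) :
    MemLp (fracFourier s (u : L2 d)) 2 volume := u.2

/-- The fractional Laplacian `(-Δ)^s u = 𝓕⁻¹ ((2π|ξ|)^{2s} û)` on its domain in `L²(ℝ^d)`. -/
def fracLaplacian (d : ℕ) (s : ℝ) : fracDomain d s →ₗ[ℂ] L2 d where
  toFun u := 𝓕⁻ (MemLp.toLp (fracFourier s (u : L2 d)) (memLp_fracFourier u) : L2 d)
  map_add' u v := by
    rw [← FourierTransform.fourierInv_add, ← MemLp.toLp_add]
    congr 1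
    exact MemLp.toLp_congr _ _ (fracFourier_add s (u : L2 d) v)
  map_smul' c u := by
    rw [RingHom.id_apply, ← FourierTransform.fourierInv_smul, ← MemLp.toLp_const_smul]
    congr 1
    exact MemLp.toLp_congr _ _ (fracFourier_smul s c (u : L2 d))

/-- The fractional Sobolev space `H^α(ℝ^d)`, the set of all `u ∈ L²` with `(-Δ)^{α/2} u ∈ L²`. It is
a type of its own, so that it carries the norm of `H^α` and not the one of `L²`. -/
def Hs (d : ℕ) (α : ℝ) : Type := fracDomain d (α / 2)

namespace Hs

variable {d : ℕ} {α : ℝ}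

instance : AddCommGroup (Hs d α) := inferInstanceAs (AddCommGroup (fracDomain d (α / 2)))

instance : Module ℂ (Hs d α) := inferInstanceAs (Module ℂ (fracDomain d (α / 2)))

/-- The inclusion `H^α ⊆ L²`. -/
def toL2 : Hs d α →ₗ[ℂ] L2 d := (fracDomain d (α / 2)).subtype

/-- The operator `(-Δ)^{α/2} : H^α → L²`. -/
def halfLap : Hs d α →ₗ[ℂ] L2 d := fracLaplacian d (α / 2)

/-- `‖u‖_{H^α} = ‖u‖_{L²} + ‖(-Δ)^{α/2} u‖_{L²}`. -/
instance : NormedAddCommGroup (Hs d α) :=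
  AddGroupNorm.toNormedAddCommGroup
    { toFun := fun u => ‖toL2 u‖ + ‖halfLap u‖
      map_zero' := by simp
      add_le' := fun u v => by
        rw [map_add, map_add]
        linarith [norm_add_le (toL2 u) (toL2 v), norm_add_le (halfLap u) (halfLap v)]
      neg' := fun u => by rw [map_neg, map_neg, norm_neg, norm_neg]
      eq_zero_of_map_eq_zero' := fun u hu => by
        have h : toL2 u = 0 := norm_eq_zero.1
          (le_antisymm (by linarith [norm_nonneg (halfLap u)]) (norm_nonneg _))
        exact Subtype.ext h }

end Hs

/-- The time derivative `∂ₜu(t)` in `L²(ℝ^d)` of a curve on `[0, T]` (one-sided at `0` and `T`). -/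
def timeDeriv {d : ℕ} {α : ℝ} (T : ℝ) (u : ℝ → Hs d α) (t : ℝ) : L2 d :=
  derivWithin (fun s => Hs.toL2 (u s)) (Icc 0 T) t

/-- `u ∈ C([0,T]; H^α) ∩ C¹([0,T]; L²)` solves `u_tt + (-Δ)^α u + m u = 0`, `u(0) = u₀`,
`u_t(0) = u₁`. The equation is read in the dual space `H^{-α}` of `H^α`: for each `φ ∈ H^α` and
`t ∈ [0,T]`, `d/dt ⟨u_t, φ⟩ + ⟨(-Δ)^{α/2} u, (-Δ)^{α/2} φ⟩ + ⟨m u, φ⟩ = 0`, with the inner products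
of `L²`. Mathlib's `inner` is conjugate-linear in its first argument, where `φ` therefore stands.
Only the values of `u` on `[0,T]` matter. -/
structure IsSolution {d : ℕ} {α : ℝ} (T : ℝ) (m : LInfty d) (u₀ : Hs d α) (u₁ : L2 d)
    (u : ℝ → Hs d α) : Prop where
  continuousOn : ContinuousOn u (Icc 0 T)
  contDiffOn : ContDiffOn ℝ 1 (fun t => Hs.toL2 (u t)) (Icc 0 T)
  equation : ∀ φ : Hs d α, ∀ t ∈ Icc 0 T,
    HasDerivWithinAt (fun s => inner ℂ (Hs.toL2 φ) (timeDeriv T u s))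
      (-(inner ℂ (Hs.halfLap φ) (Hs.halfLap (u t))
        + inner ℂ (Hs.toL2 φ) (m • Hs.toL2 (u t) : L2 d))) (Icc 0 T) t
  initial_value : u 0 = u₀
  initial_velocity : timeDeriv T u 0 = u₁

end FractionalKleinGordon

end

/-! Let `ω = (1 + (-Δ)^α)^{1/2}`, `J = ω⁻¹` and `B = 1 - m`, so that the equation reads `u'' + ω² u
= B u` with `B` bounded and symmetric. Put `y = ω u` and `z = u'`. Then `u ∈ H^α` amounts to `y ∈
L²`, and `p = z + i y`, `q = z - i y` satisfy `p' = iω p + B J y`, `q' = -iω q + B J y`. Undoing the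
free flow, `P = exp(-itω) p` and `Q = exp(itω) q` solve an ODE in `L² × L²` whose right-hand side is
bounded and linear. Picard–Lindelöf and Gronwall give a solution on all of `[0, T]`
(`exists_isWeakSolution`).

The unbounded `ω` never appears in the abstract part: equations are multiplied by the bounded
operator `J`. Uniqueness (`IsWeakSolution.eq_zero`) is a Gronwall argument for an energy one order
lower, where `u'` is differentiable in norm.

The bound comes from conservation of `‖u'‖² + ‖(-Δ)^{α/2} u‖² + ⟨m u, u⟩`. As `m ≥ 0`, this controls
the first two terms by the data with a factor `1 + ‖m‖`. The missing `‖u‖` is recovered by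
integrating `u'` in time, which makes the constant depend on `T`. -/

noncomputable section

namespace FractionalKleinGordon

open Filter Topology
open scoped NNReal ComplexInnerProductSpace

/-! ### Global solutions of Lipschitz ODEs in a Banach space. -/

section ODE

variable {E : Type*} [NormedAddCommGroup E] [NormedSpace ℝ E]

/-- The radial retraction onto the closed ball of radius `R`. -/
def radialRetract (R : ℝ) (x : E) : E := (R / max R ‖x‖) • x

lemma radialRetract_of_norm_le {R : ℝ} (hR : 0 < R) {x : E} (hx : ‖x‖ ≤ R) :
    radialRetract R x = x := by
  rw [radialRetract, max_eq_left hx, div_self hR.ne', one_smul]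

lemma norm_radialRetract_le_norm {R : ℝ} (hR : 0 < R) (x : E) : ‖radialRetract R x‖ ≤ ‖x‖ := by
  have h : 0 < max R ‖x‖ := lt_max_of_lt_left hR
  rw [radialRetract, norm_smul, Real.norm_of_nonneg (by positivity)]
  exact mul_le_of_le_one_left (norm_nonneg _) ((div_le_one h).2 (le_max_left _ _))

lemma norm_radialRetract_le {R : ℝ} (hR : 0 < R) (x : E) : ‖radialRetract R x‖ ≤ R := by
  have h : 0 < max R ‖x‖ := lt_max_of_lt_left hR
  rw [radialRetract, norm_smul, Real.norm_of_nonneg (by positivity), div_mul_eq_mul_div,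
    div_le_iff₀ h]
  exact mul_le_mul_of_nonneg_left (le_max_right _ _) hR.le

/-- The difference splits into `x - y` rescaled and `y` times the change of the scaling factor. Each
part costs at most `‖x - y‖`, the second because `max R ‖·‖` is 1-Lipschitz. -/
lemma norm_radialRetract_sub_le {R : ℝ} (hR : 0 < R) (x y : E) :
    ‖radialRetract R x - radialRetract R y‖ ≤ 2 * ‖x - y‖ := by
  have hx : 0 < max R ‖x‖ := lt_max_of_lt_left hR
  have hy : 0 < max R ‖y‖ := lt_max_of_lt_left hR
  have hsplit : radialRetract R x - radialRetract R y
      = (R / max R ‖x‖) • (x - y) + (R / max R ‖x‖ - R / max R ‖y‖) • y := by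
    simp only [radialRetract]; module
  have hle : R / max R ‖x‖ ≤ 1 := (div_le_one hx).2 (le_max_left _ _)
  have h1 : ‖(R / max R ‖x‖) • (x - y)‖ ≤ ‖x - y‖ := by
    rw [norm_smul, Real.norm_of_nonneg (by positivity)]
    exact mul_le_of_le_one_left (norm_nonneg _) hle
  have h2 : ‖(R / max R ‖x‖ - R / max R ‖y‖) • y‖ ≤ ‖x - y‖ := by
    have hq : R / max R ‖x‖ - R / max R ‖y‖
        = (R / max R ‖x‖) * ((max R ‖y‖ - max R ‖x‖) / max R ‖y‖) := by
      field_simp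
    have hm : |max R ‖y‖ - max R ‖x‖| ≤ ‖x - y‖ := by
      refine (abs_max_sub_max_le_max R ‖y‖ R ‖x‖).trans ?_
      rw [sub_self, abs_zero, max_eq_right (abs_nonneg _), norm_sub_rev]
      exact abs_norm_sub_norm_le y x
    have hy1 : ‖y‖ / max R ‖y‖ ≤ 1 := (div_le_one hy).2 (le_max_right _ _)
    rw [norm_smul, hq, Real.norm_eq_abs, abs_mul,
      abs_of_nonneg (by positivity : 0 ≤ R / max R ‖x‖), abs_div, abs_of_pos hy]
    calc R / max R ‖x‖ * (|max R ‖y‖ - max R ‖x‖| / max R ‖y‖) * ‖y‖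
        = (R / max R ‖x‖) * (‖y‖ / max R ‖y‖) * |max R ‖y‖ - max R ‖x‖| := by ring
      _ ≤ 1 * 1 * ‖x - y‖ := by gcongr
      _ = ‖x - y‖ := by ring
  rw [hsplit, two_mul]
  exact (norm_add_le _ _).trans (add_le_add h1 h2)

lemma _root_.HasDerivWithinAt.Ici_of_Icc {f : ℝ → E} {f' : E} {a b t : ℝ} (ht : t ∈ Ico a b)
    (hf : HasDerivWithinAt f f' (Icc a b) t) : HasDerivWithinAt f f' (Ici t) t :=
  hf.mono_of_mem_nhdsWithin (Icc_mem_nhdsGE_of_mem ht)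

/-- Global solvability of the initial value problem for a globally Lipschitz vector field which
vanishes at the origin. -/
theorem exists_forall_hasDerivWithinAt_of_lipschitz [CompleteSpace E] {T : ℝ} (hT : 0 ≤ T)
    {f : ℝ → E → E} {K : ℝ≥0} (hf : ∀ t, LipschitzWith K (f t)) (hf0 : ∀ t, f t 0 = 0)
    (hc : ∀ x, Continuous fun t => f t x) (x₀ : E) :
    ∃ x : ℝ → E, x 0 = x₀ ∧
      ∀ t ∈ Icc 0 T, HasDerivWithinAt x (f t (x t)) (Icc 0 T) t := by
  have hfn : ∀ t x, ‖f t x‖ ≤ K * ‖x‖ := fun t x => by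
    simpa [hf0 t] using (hf t).norm_sub_le x 0
  -- The Gronwall bound for a solution on `[0, T]`, plus 1 for positivity. The truncation at this
  -- radius is never active along the solution.
  set R : ℝ := ‖x₀‖ * Real.exp (K * T) + 1 with hRdef
  have hR : 0 < R := by positivity
  let R' : ℝ≥0 := ⟨R, hR.le⟩
  let T' : ℝ≥0 := ⟨T, hT⟩
  -- The truncated field is bounded by `K R` everywhere, so the ball of radius `K R T` contains the
  -- solution for the whole time interval.
  have hP : IsPicardLindelof (fun t x => f t (radialRetract R x)) (tmin := 0) (tmax := T)
      ⟨0, left_mem_Icc.2 hT⟩ x₀ (K * R' * T') 0 (K * R') (K * 2) := by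
    refine ⟨fun t _ => ?_, fun x _ => (hc _).continuousOn, fun t _ x _ => ?_, ?_⟩
    · refine ((hf t).comp (LipschitzWith.of_dist_le_mul fun x y => ?_)).lipschitzOnWith
      simpa [dist_eq_norm] using norm_radialRetract_sub_le hR x y
    · exact (hfn t _).trans (mul_le_mul_of_nonneg_left (norm_radialRetract_le hR x) K.2)
    · simp only [NNReal.coe_mul, NNReal.coe_zero, sub_zero, sub_self, max_eq_left hT]; exact le_rfl
  obtain ⟨x, hx0, hx⟩ := hP.exists_eq_forall_mem_Icc_hasDerivWithinAt₀
  refine ⟨x, hx0, fun t ht => ?_⟩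
  have hbound : ‖x t‖ ≤ R := by
    have h := norm_le_gronwallBound_of_norm_deriv_right_le (δ := ‖x₀‖) (K := K) (ε := 0)
      (fun s hs => (hx s hs).continuousWithinAt)
      (fun s hs => (hx s (Ico_subset_Icc_self hs)).Ici_of_Icc hs) (by simp_all)
      (fun s _ => by
        rw [add_zero]
        exact (hfn s _).trans (mul_le_mul_of_nonneg_left (norm_radialRetract_le_norm hR _) K.2))
      t ht
    rw [gronwallBound_ε0, sub_zero] at h
    have : Real.exp (K * t) ≤ Real.exp (K * T) :=
      Real.exp_le_exp.2 (mul_le_mul_of_nonneg_left ht.2 K.2)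
    nlinarith [norm_nonneg x₀]
  simpa only [radialRetract_of_norm_le hR hbound] using hx t ht

end ODE

/-! ### The abstract equation in a Hilbert space: uniqueness, existence, energy. -/

section Abstract

variable {H : Type*} [NormedAddCommGroup H] [InnerProductSpace ℂ H]

lemma tendsto_clm_apply {ι : Type*} {l : Filter ι} {W : ι → H →L[ℂ] H} {C : ℝ}
    (hC : ∀ s x, ‖W s x‖ ≤ C * ‖x‖) {f : ι → H} {x y : H}
    (hW : Tendsto (fun s => W s x) l (𝓝 y)) (hf : Tendsto f l (𝓝 x)) :
    Tendsto (fun s => W s (f s)) l (𝓝 y) := by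
  have h : Tendsto (fun s => W s (f s - x)) l (𝓝 0) := by
    refine squeeze_zero_norm (fun s => hC s _) ?_
    simpa using ((hf.sub_const x).norm).const_mul C
  simpa using h.add hW

variable [NormedSpace ℝ H]

/-- The product rule for a bounded, strongly differentiable family of operators. -/
lemma hasDerivWithinAt_clm_apply [IsScalarTower ℝ ℂ H] {W : ℝ → H →L[ℂ] H} {C : ℝ}
    (hC : ∀ s x, ‖W s x‖ ≤ C * ‖x‖) {f : ℝ → H} {f' w : H} {S : Set ℝ} {t : ℝ}
    (hc : ContinuousWithinAt (fun s => W s f') S t)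
    (hd : HasDerivWithinAt (fun s => W s (f t)) w S t) (hf : HasDerivWithinAt f f' S t) :
    HasDerivWithinAt (fun s => W s (f s)) (w + W t f') S t := by
  rw [hasDerivWithinAt_iff_tendsto_slope] at *
  have h := tendsto_clm_apply hC (hc.mono_left (nhdsWithin_mono _ sdiff_subset)) hf
  refine (hd.add h).congr fun s => ?_
  simp only [slope_def_module, ContinuousLinearMap.map_smul_of_tower, map_sub]
  module

lemma _root_.HasDerivWithinAt.norm_sq_complex {f : ℝ → H} {f' : H} {S : Set ℝ} {t : ℝ}
    (hf : HasDerivWithinAt f f' S t) :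
    HasDerivWithinAt (fun s => ‖f s‖ ^ 2) (2 * (⟪f t, f'⟫ : ℂ).re) S t := by
  have h := Complex.reCLM.hasFDerivAt.comp_hasDerivWithinAt t (hf.inner ℂ hf)
  have h1 : ∀ s, ‖f s‖ ^ 2 = (⟪f s, f s⟫ : ℂ).re := fun s => by
    rw [← inner_self_eq_norm_sq (𝕜 := ℂ)]; rfl
  simp only [h1]
  refine h.congr_deriv ?_
  rw [Complex.reCLM_apply, Complex.add_re, ← inner_conj_symm f' (f t), Complex.conj_re]
  ring

/-- A weak derivative which is continuous is a derivative in norm. -/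
lemma hasDerivWithinAt_of_forall_inner [CompleteSpace H] {T : ℝ} {f g : ℝ → H}
    (hg : ContinuousOn g (Icc 0 T))
    (h : ∀ ψ : H, ∀ t ∈ Icc 0 T,
      HasDerivWithinAt (fun s => (⟪ψ, f s⟫ : ℂ)) ⟪ψ, g t⟫ (Icc 0 T) t) :
    ∀ t ∈ Icc 0 T, HasDerivWithinAt f (g t) (Icc 0 T) t := by
  have hG : ∀ t ∈ Icc 0 T, HasDerivWithinAt (fun s => ∫ r in (0 : ℝ)..s, g r) (g t) (Icc 0 T) t := by
    intro t ht
    have : Fact (t ∈ Icc 0 T) := ⟨ht⟩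
    refine intervalIntegral.integral_hasDerivWithinAt_right
      ((hg.mono ?_).intervalIntegrable) ?_ (hg t ht)
    · rw [uIcc_of_le ht.1]; exact Icc_subset_Icc_right ht.2
    · exact hg.stronglyMeasurableAtFilter_nhdsWithin measurableSet_Icc t
  -- Tested against any `ψ`, `f` and the primitive of `g` have the same derivative, so they differ
  -- by a constant.
  have key : ∀ t ∈ Icc 0 T, f t = f 0 + ∫ r in (0 : ℝ)..t, g r := by
    intro t ht
    refine ext_inner_left ℂ fun ψ => ?_
    have hd : ∀ s ∈ Icc 0 T, HasDerivWithinAt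
        (fun s => (⟪ψ, f s⟫ : ℂ) - ⟪ψ, ∫ r in (0 : ℝ)..s, g r⟫) 0 (Icc 0 T) s := fun s hs => by
      have h2 := (hasDerivWithinAt_const s (Icc 0 T) ψ).inner ℂ (hG s hs)
      exact ((h ψ s hs).sub h2).congr_deriv (by simp)
    have hT : (0 : ℝ) < T ∨ t = 0 := by
      rcases (ht.1.trans ht.2).lt_or_eq with h | h
      · exact .inl h
      · exact .inr (le_antisymm (h ▸ ht.2) ht.1)
    rcases hT with hT | rfl
    · have := constant_of_derivWithin_zero (fun s hs => (hd s hs).differentiableWithinAt)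
        (fun s hs => (hd s (Ico_subset_Icc_self hs)).derivWithin
          (uniqueDiffOn_Icc hT s (Ico_subset_Icc_self hs))) t ht
      simp only [intervalIntegral.integral_same, inner_zero_right, sub_zero] at this
      rw [inner_add_right, ← this]; ring
    · simp
  intro t ht
  refine ((hG t ht).const_add (f 0)).congr (fun s hs => key s hs) (key t ht)

/-- The pair `(y, z)` solves `(J y)' = z`, `(J z)' = -y + J B J y` on `[0, T]`, the latter equation
being read weakly. With `J = (1 + A²)^{-1/2}` and `u = J y`, this is
`u'' + A² u + (1 - B) u = 0`. -/
structure IsWeakSolution (J B : H →L[ℂ] H) (T : ℝ) (y₀ z₀ : H) (y z : ℝ → H) : Prop where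
  continuousOn_fst : ContinuousOn y (Icc 0 T)
  continuousOn_snd : ContinuousOn z (Icc 0 T)
  hasDeriv : ∀ t ∈ Icc 0 T, HasDerivWithinAt (fun s => J (y s)) (z t) (Icc 0 T) t
  equation : ∀ ψ : H, ∀ t ∈ Icc 0 T,
    HasDerivWithinAt (fun s => (⟪J ψ, z s⟫ : ℂ)) (-⟪ψ, y t⟫ + ⟪J ψ, B (J (y t))⟫) (Icc 0 T) t
  initial_fst : y 0 = y₀
  initial_snd : z 0 = z₀

/-- Since `z` is only weakly differentiable, the usual energy cannot be differentiated directly.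
After applying `J` it can: in the derivative of `‖J z‖² + ‖J y‖²` the terms `-⟨J z, y⟩` and `⟨J y,
z⟩` cancel in real part by symmetry of `J`, and the rest is at most `‖J B‖` times the energy. -/
lemma IsWeakSolution.eq_zero [IsScalarTower ℝ ℂ H] [CompleteSpace H] {J B : H →L[ℂ] H}
    (hJ : ∀ x y : H, (⟪J x, y⟫ : ℂ) = ⟪x, J y⟫) {T : ℝ} {y z : ℝ → H}
    (h : IsWeakSolution J B T 0 0 y z) : ∀ t ∈ Icc 0 T, J (y t) = 0 := by
  have hz : ∀ t ∈ Icc 0 T,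
      HasDerivWithinAt (fun s => J (z s)) (-y t + J (B (J (y t)))) (Icc 0 T) t := by
    refine hasDerivWithinAt_of_forall_inner ?_ fun ψ t ht => ?_
    · exact h.continuousOn_fst.neg.add
        ((J ∘L B ∘L J).continuous.comp_continuousOn h.continuousOn_fst)
    · simpa [hJ, inner_add_right] using h.equation ψ t ht
  have hE : ∀ t ∈ Icc 0 T, HasDerivWithinAt (fun s => ‖J (z s)‖ ^ 2 + ‖J (y s)‖ ^ 2)
      (2 * (⟪J (z t), J (B (J (y t)))⟫ : ℂ).re) (Icc 0 T) t := fun t ht => by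
    refine ((hz t ht).norm_sq_complex.add (h.hasDeriv t ht).norm_sq_complex).congr_deriv ?_
    rw [inner_add_right, inner_neg_right, Complex.add_re, Complex.neg_re, hJ (z t) (y t),
      ← inner_conj_symm (J (y t)) (z t), Complex.conj_re]
    ring
  have h0 := eq_zero_of_abs_deriv_le_mul_abs_self_of_eq_zero_right (K := ‖J ∘L B‖)
    (fun t ht => (hE t ht).continuousWithinAt)
    (fun t ht => (hE t (Ico_subset_Icc_self ht)).Ici_of_Icc ht)
    (by simp [h.initial_fst, h.initial_snd]) (fun t _ => by
      have h1 : |(⟪J (z t), J (B (J (y t)))⟫ : ℂ).re| ≤ ‖J (z t)‖ * (‖J ∘L B‖ * ‖J (y t)‖) :=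
        (Complex.abs_re_le_norm _).trans ((norm_inner_le_norm _ _).trans
          (mul_le_mul_of_nonneg_left ((J ∘L B).le_opNorm _) (norm_nonneg _)))
      rw [Real.norm_eq_abs, abs_mul, abs_two, Real.norm_of_nonneg (by positivity)]
      nlinarith [norm_nonneg (J ∘L B), mul_nonneg (norm_nonneg (J ∘L B))
        (sq_nonneg (‖J (z t)‖ - ‖J (y t)‖))])
  intro t ht
  have := h0 t ht
  have h2 : ‖J (y t)‖ ^ 2 = 0 := by nlinarith [sq_nonneg ‖J (z t)‖, sq_nonneg ‖J (y t)‖]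
  simpa using h2

/-- `V` is the unitary group `t ↦ exp (itω)`, where `ω = J⁻¹`. -/
structure IsUnitaryGroup (J : H →L[ℂ] H) (V : ℝ → H →L[ℂ] H) : Prop where
  zero : ∀ x, V 0 x = x
  inner_map : ∀ t x y, (⟪V t x, V t y⟫ : ℂ) = ⟪x, y⟫
  apply_neg : ∀ t x, V t (V (-t) x) = x
  comm : ∀ t x, J (V t x) = V t (J x)
  continuous : ∀ x, Continuous fun t => V t x
  hasDeriv : ∀ x t, HasDerivAt (fun s => V s (J x)) (Complex.I • V t x) t

namespace IsUnitaryGroup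

variable {J : H →L[ℂ] H} {V : ℝ → H →L[ℂ] H}

lemma norm_map (h : IsUnitaryGroup J V) (t : ℝ) (x : H) : ‖V t x‖ = ‖x‖ := by
  have := h.inner_map t x x
  rw [inner_self_eq_norm_sq_to_K, inner_self_eq_norm_sq_to_K] at this
  exact (pow_left_inj₀ (norm_nonneg _) (norm_nonneg _) two_ne_zero).1 (by exact_mod_cast this)

lemma norm_le (h : IsUnitaryGroup J V) (t : ℝ) (x : H) : ‖V t x‖ ≤ 1 * ‖x‖ := by
  rw [h.norm_map, one_mul]

lemma neg_apply (h : IsUnitaryGroup J V) (t : ℝ) (x : H) : V (-t) (V t x) = x := by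
  simpa using h.apply_neg (-t) x

lemma inner_neg_right (h : IsUnitaryGroup J V) (t : ℝ) (x y : H) :
    (⟪x, V (-t) y⟫ : ℂ) = ⟪V t x, y⟫ := by
  rw [← h.inner_map t, h.apply_neg]

lemma inner_right (h : IsUnitaryGroup J V) (t : ℝ) (x y : H) :
    (⟪x, V t y⟫ : ℂ) = ⟪V (-t) x, y⟫ := by
  rw [← h.inner_map (-t), h.neg_apply]

lemma continuousOn_apply (h : IsUnitaryGroup J V) {S : Set ℝ} {f : ℝ → H} (hf : ContinuousOn f S) :
    ContinuousOn (fun t => V t (f t)) S := fun t ht =>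
  tendsto_clm_apply h.norm_le ((h.continuous (f t)).continuousWithinAt) (hf t ht)

lemma continuousOn_neg_apply (h : IsUnitaryGroup J V) {S : Set ℝ} {f : ℝ → H}
    (hf : ContinuousOn f S) : ContinuousOn (fun t => V (-t) (f t)) S := fun t ht =>
  tendsto_clm_apply (fun s => h.norm_le (-s))
    (((h.continuous (f t)).comp continuous_neg).continuousWithinAt) (hf t ht)

lemma hasDerivWithinAt_apply [IsScalarTower ℝ ℂ H] (h : IsUnitaryGroup J V) {S : Set ℝ} {t : ℝ} {f : ℝ → H} {g : H}
    (hf : HasDerivWithinAt f (V (-t) g) S t) :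
    HasDerivWithinAt (fun s => J (V s (f s))) (Complex.I • V t (f t) + J g) S t := by
  have hd := hasDerivWithinAt_clm_apply (W := fun s => J ∘L V s) (C := ‖J‖)
    (fun s x => (J.le_opNorm _).trans_eq (congrArg (‖J‖ * ·) (h.norm_map _ x)))
    (J.continuous.comp (h.continuous _)).continuousWithinAt
    (by simpa only [ContinuousLinearMap.comp_apply, h.comm]
      using (h.hasDeriv (f t) t).hasDerivWithinAt) hf
  simpa only [ContinuousLinearMap.comp_apply, h.apply_neg] using hd

lemma hasDerivWithinAt_neg_apply [IsScalarTower ℝ ℂ H] (h : IsUnitaryGroup J V) {S : Set ℝ} {t : ℝ} {f : ℝ → H} {g : H}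
    (hf : HasDerivWithinAt f (V t g) S t) :
    HasDerivWithinAt (fun s => J (V (-s) (f s))) (-(Complex.I • V (-t) (f t)) + J g) S t := by
  have hd := hasDerivWithinAt_clm_apply (W := fun s => J ∘L V (-s)) (C := ‖J‖)
    (fun s x => (J.le_opNorm _).trans_eq (congrArg (‖J‖ * ·) (h.norm_map _ x)))
    (J.continuous.comp ((h.continuous _).comp continuous_neg)).continuousWithinAt
    (by simpa [Function.comp_def, h.comm] using
      ((h.hasDeriv (f t) (-t)).scomp t (hasDerivAt_neg t)).hasDerivWithinAt) hf
  simpa only [ContinuousLinearMap.comp_apply, h.neg_apply] using hd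

end IsUnitaryGroup

/-- Existence and conservation of energy. In the interaction picture `p = V t P`, `q = V (-t) Q`,
with `p = z + i y` and `q = z - i y`, the system becomes an ordinary differential equation with a
bounded vector field. -/
theorem exists_isWeakSolution [IsScalarTower ℝ ℂ H] [CompleteSpace H] {J B : H →L[ℂ] H} {V : ℝ → H →L[ℂ] H}
    (hV : IsUnitaryGroup J V) (hJ : ∀ x y : H, (⟪J x, y⟫ : ℂ) = ⟪x, J y⟫)
    (hB : ∀ x y : H, (⟪B x, y⟫ : ℂ) = ⟪x, B y⟫) {T : ℝ} (hT : 0 < T) (y₀ z₀ : H) :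
    ∃ y z : ℝ → H, IsWeakSolution J B T y₀ z₀ y z ∧ ∀ t ∈ Icc 0 T,
      ‖z t‖ ^ 2 + ‖y t‖ ^ 2 - (⟪J (y t), B (J (y t))⟫ : ℂ).re
        = ‖z₀‖ ^ 2 + ‖y₀‖ ^ 2 - (⟪J y₀, B (J y₀)⟫ : ℂ).re := by
  -- This recovers `y = (p - q) / (2i)` from the pair `(P, Q)`.
  let Y : ℝ → H × H → H := fun t w => (-(Complex.I / 2)) • (V t w.1 - V (-t) w.2)
  have hY : ∀ t v w, Y t v - Y t w = Y t (v - w) := fun t v w => by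
    simp only [Y, Prod.fst_sub, Prod.snd_sub, map_sub]; module
  have hYn : ∀ t w, ‖Y t w‖ ≤ ‖w‖ := fun t w => by
    have h1 := norm_sub_le (V t w.1) (V (-t) w.2)
    rw [hV.norm_map, hV.norm_map] at h1
    have h2 := norm_fst_le w
    have h3 := norm_snd_le w
    simp only [Y, norm_smul, norm_neg, norm_div, Complex.norm_I, Complex.norm_ofNat]
    linarith
  have hYc : ∀ w, Continuous fun t => Y t w := fun w =>
    ((hV.continuous w.1).sub ((hV.continuous w.2).comp continuous_neg)).const_smul _
  let M : H →L[ℂ] H := B ∘L J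
  let F : ℝ → H × H → H × H := fun t w => (V (-t) (M (Y t w)), V t (M (Y t w)))
  have hF : ∀ t, LipschitzWith ‖M‖₊ (F t) := fun t => by
    refine LipschitzWith.of_dist_le_mul fun v w => ?_
    have h1 : ‖M (Y t v) - M (Y t w)‖ ≤ ‖M‖ * ‖v - w‖ := by
      rw [← map_sub, hY]
      exact (M.le_opNorm _).trans (mul_le_mul_of_nonneg_left (hYn _ _) (norm_nonneg _))
    rw [dist_eq_norm, dist_eq_norm, Prod.norm_def]
    simp only [F, Prod.fst_sub, Prod.snd_sub, ← map_sub (V _), hV.norm_map, max_self]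
    exact h1
  have hF0 : ∀ t, F t 0 = 0 := fun t => by simp [F, Y]
  have hFc : ∀ w, Continuous fun t => F t w := fun w => by
    have hc : ContinuousOn (fun t => M (Y t w)) univ := (M.continuous.comp (hYc w)).continuousOn
    exact (continuousOn_univ.1 (hV.continuousOn_neg_apply hc)).prodMk
      (continuousOn_univ.1 (hV.continuousOn_apply hc))
  obtain ⟨w, hw0, hw⟩ := exists_forall_hasDerivWithinAt_of_lipschitz hT.le hF hF0 hFc
    (z₀ + Complex.I • y₀, z₀ - Complex.I • y₀)
  have hwc : ContinuousOn w (Icc 0 T) := fun t ht => (hw t ht).continuousWithinAt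
  have hP : ∀ t ∈ Icc 0 T, HasDerivWithinAt (fun s => (w s).1) (V (-t) (M (Y t (w t)))) (Icc 0 T) t :=
    fun t ht => (hw t ht).fst
  have hQ : ∀ t ∈ Icc 0 T, HasDerivWithinAt (fun s => (w s).2) (V t (M (Y t (w t)))) (Icc 0 T) t :=
    fun t ht => (hw t ht).snd
  let p : ℝ → H := fun t => V t (w t).1
  let q : ℝ → H := fun t => V (-t) (w t).2
  let y : ℝ → H := fun t => (-(Complex.I / 2)) • (p t - q t)
  let z : ℝ → H := fun t => (2 : ℂ)⁻¹ • (p t + q t)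
  have hp : ContinuousOn p (Icc 0 T) := hV.continuousOn_apply hwc.fst
  have hq : ContinuousOn q (Icc 0 T) := hV.continuousOn_neg_apply hwc.snd
  have hJp : ∀ t ∈ Icc 0 T, HasDerivWithinAt (fun s => J (p s))
      (Complex.I • p t + J (M (y t))) (Icc 0 T) t := fun t ht => hV.hasDerivWithinAt_apply (hP t ht)
  have hJq : ∀ t ∈ Icc 0 T, HasDerivWithinAt (fun s => J (q s))
      (-(Complex.I • q t) + J (M (y t))) (Icc 0 T) t :=
    fun t ht => hV.hasDerivWithinAt_neg_apply (hQ t ht)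
  have hJy : ∀ t ∈ Icc 0 T, HasDerivWithinAt (fun s => J (y s)) (z t) (Icc 0 T) t := by
    intro t ht
    have h := ((hJp t ht).sub (hJq t ht)).const_smul ((-(Complex.I / 2)))
    simp only [y, map_smul, map_sub]
    refine h.congr_deriv ?_
    simp only [z]
    linear_combination (norm := module) ((-1 / 2 : ℂ) • Complex.I_mul_I) • (p t + q t)
  have hJz : ∀ t ∈ Icc 0 T,
      HasDerivWithinAt (fun s => J (z s)) (-y t + J (M (y t))) (Icc 0 T) t := by
    intro t ht
    have h := ((hJp t ht).add (hJq t ht)).const_smul ((2 : ℂ)⁻¹)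
    simp only [z, map_smul, map_add]
    refine h.congr_deriv ?_
    simp only [y]
    module
  have hy0 : y 0 = y₀ := by
    simp only [y, p, q, neg_zero, hV.zero, hw0]
    linear_combination (norm := module) ((-1 : ℂ) • Complex.I_mul_I) • y₀
  have hz0 : z 0 = z₀ := by
    simp only [z, p, q, neg_zero, hV.zero, hw0]
    module
  refine ⟨y, z, ⟨(hp.sub hq).const_smul _, (hp.add hq).const_smul _, hJy, fun ψ t ht => ?_, hy0, hz0⟩,
    fun t ht => ?_⟩
  · have h := (hasDerivWithinAt_const t (Icc 0 T) ψ).inner ℂ (hJz t ht)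
    simp only [hJ]
    exact h.congr_deriv (by simp [inner_add_right, M])
  -- Neither `z` nor `y` need be differentiable in norm, but `P` and `Q` are. The parallelogram law
  -- and unitarity rewrite the quadratic energy in terms of these.
  · have hN : ∀ s, ‖z s‖ ^ 2 + ‖y s‖ ^ 2 = 2⁻¹ * (‖(w s).1‖ ^ 2 + ‖(w s).2‖ ^ 2) := fun s => by
      have h := parallelogram_law_with_norm ℂ (p s) (q s)
      rw [hV.norm_map, hV.norm_map] at h
      simp only [z, y, norm_smul, norm_neg, norm_div, norm_inv, Complex.norm_I, Complex.norm_ofNat]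
      linarith
    have hD : ∀ s ∈ Icc 0 T, HasDerivWithinAt
        (fun s => ‖z s‖ ^ 2 + ‖y s‖ ^ 2 - (⟪J (y s), B (J (y s))⟫ : ℂ).re) 0 (Icc 0 T) s := by
      intro s hs
      have hBJ := ((B.restrictScalars ℝ).hasFDerivAt.comp_hasDerivWithinAt s (hJy s hs))
      have h1 := Complex.reCLM.hasFDerivAt.comp_hasDerivWithinAt s ((hJy s hs).inner ℂ hBJ)
      have h2 := ((hP s hs).norm_sq_complex.add (hQ s hs).norm_sq_complex).const_mul (2⁻¹ : ℝ)
      simp only [hN]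
      refine (h2.sub h1).congr_deriv ?_
      -- Both parts of the energy have derivative `2 Re ⟨z, B J y⟩`: the potential part by symmetry
      -- of `B`, the quadratic part since `z = (p + q) / 2`.
      have h3 : (⟪J (y s), B (z s)⟫ : ℂ).re = (⟪z s, M (y s)⟫ : ℂ).re := by
        rw [← hB, ← inner_conj_symm, Complex.conj_re]; rfl
      have h4 : (⟪z s, M (y s)⟫ : ℂ).re
          = 2⁻¹ * ((⟪p s, M (y s)⟫ : ℂ).re + (⟪q s, M (y s)⟫ : ℂ).re) := by
        simp only [z, inner_smul_left, inner_add_left]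
        simp
      rw [hV.inner_neg_right, hV.inner_right, Complex.reCLM_apply, Complex.add_re]
      change _ - ((⟪J (y s), B (z s)⟫ : ℂ).re + (⟪z s, M (y s)⟫ : ℂ).re) = 0
      rw [h3, h4]
      change 2⁻¹ * (2 * (⟪p s, M (y s)⟫ : ℂ).re + 2 * (⟪q s, M (y s)⟫ : ℂ).re) - _ = 0
      ring
    have h := constant_of_derivWithin_zero (fun s hs => (hD s hs).differentiableWithinAt)
      (fun s hs => (hD s (Ico_subset_Icc_self hs)).derivWithin
        (uniqueDiffOn_Icc hT s (Ico_subset_Icc_self hs))) t ht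
    simpa only [hy0, hz0] using h

end Abstract

/-! ### Bounded Fourier multipliers on `L²`. -/

section FourierMultiplier

variable {d : ℕ}

lemma ext_fourier {u v : L2 d} (h : (𝓕 u : L2 d) =ᵐ[volume] (𝓕 v : L2 d)) : u = v :=
  (Lp.fourierTransformₗᵢ (EuclideanSpace ℝ (Fin d)) ℂ).injective (Lp.ext h)

lemma inner_eq_integral_fourier (u v : L2 d) :
    (⟪u, v⟫ : ℂ) = ∫ ξ, (⟪(𝓕 u : L2 d) ξ, (𝓕 v : L2 d) ξ⟫ : ℂ) := by
  rw [← Lp.inner_fourier_eq, L2.inner_def]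

lemma norm_sq_eq_integral_fourier (u : L2 d) : ‖u‖ ^ 2 = ∫ ξ, ‖(𝓕 u : L2 d) ξ‖ ^ 2 := by
  have h : ((‖u‖ ^ 2 : ℝ) : ℂ) = ((∫ ξ, ‖(𝓕 u : L2 d) ξ‖ ^ 2 : ℝ) : ℂ) := by
    rw [← integral_complex_ofReal]
    have := inner_eq_integral_fourier u u
    simp only [inner_self_eq_norm_sq_to_K] at this
    exact_mod_cast this
  exact_mod_cast h

/-- The operator with bounded Fourier symbol `f`. -/
def fourierMul (f : EuclideanSpace ℝ (Fin d) → ℂ) (hf : MemLp f ∞ volume) : L2 d →L[ℂ] L2 d :=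
  ((Lp.fourierTransformₗᵢ (EuclideanSpace ℝ (Fin d)) ℂ).symm.toContinuousLinearEquiv :
      L2 d →L[ℂ] L2 d) ∘L
    ((ContinuousLinearMap.mul ℂ ℂ).holderL volume ∞ 2 2 (hf.toLp f)) ∘L
    ((Lp.fourierTransformₗᵢ (EuclideanSpace ℝ (Fin d)) ℂ).toContinuousLinearEquiv :
      L2 d →L[ℂ] L2 d)

lemma fourier_fourierMul {f : EuclideanSpace ℝ (Fin d) → ℂ} (hf : MemLp f ∞ volume) (u : L2 d) :
    (𝓕 (fourierMul f hf u) : L2 d) =ᵐ[volume] fun ξ => f ξ * (𝓕 u : L2 d) ξ := by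
  have h : (𝓕 (fourierMul f hf u) : L2 d)
      = (ContinuousLinearMap.mul ℂ ℂ).holder 2 (hf.toLp f) (𝓕 u : L2 d) :=
    (Lp.fourierTransformₗᵢ (EuclideanSpace ℝ (Fin d)) ℂ).apply_symm_apply _
  rw [h]
  filter_upwards [(ContinuousLinearMap.mul ℂ ℂ).coeFn_holder (r := 2) (hf.toLp f) (𝓕 u : L2 d),
    hf.coeFn_toLp] with ξ h1 h2
  rw [h1, h2, ContinuousLinearMap.mul_apply']

lemma inner_fourierMul_left {f : EuclideanSpace ℝ (Fin d) → ℂ} (hf : MemLp f ∞ volume)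
    (hreal : ∀ ξ, starRingEnd ℂ (f ξ) = f ξ) (u v : L2 d) :
    (⟪fourierMul f hf u, v⟫ : ℂ) = ⟪u, fourierMul f hf v⟫ := by
  rw [inner_eq_integral_fourier, inner_eq_integral_fourier]
  refine integral_congr_ae ?_
  filter_upwards [fourier_fourierMul hf u, fourier_fourierMul hf v] with ξ h1 h2
  simp only [h1, h2, RCLike.inner_apply, map_mul, hreal]
  ring

lemma fourier_add_ae (u v : L2 d) :
    (𝓕 (u + v) : L2 d) =ᵐ[volume] fun ξ => (𝓕 u : L2 d) ξ + (𝓕 v : L2 d) ξ := by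
  have h : (𝓕 (u + v) : L2 d) = 𝓕 u + 𝓕 v := FourierTransform.fourier_add u v
  rw [h]
  exact Lp.coeFn_add _ _

lemma fourier_smul_ae (c : ℂ) (u : L2 d) :
    (𝓕 (c • u) : L2 d) =ᵐ[volume] fun ξ => c * (𝓕 u : L2 d) ξ := by
  have h : (𝓕 (c • u) : L2 d) = c • 𝓕 u := FourierTransform.fourier_smul c u
  rw [h]
  exact Lp.coeFn_smul _ _

lemma fourier_sub_ae (u v : L2 d) :
    (𝓕 (u - v) : L2 d) =ᵐ[volume] fun ξ => (𝓕 u : L2 d) ξ - (𝓕 v : L2 d) ξ := by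
  have h : (𝓕 (u - v) : L2 d) = 𝓕 u - 𝓕 v :=
    (Lp.fourierTransformₗᵢ (EuclideanSpace ℝ (Fin d)) ℂ).map_sub u v
  rw [h]
  exact Lp.coeFn_sub _ _

/-- Strong convergence of operators whose symbols are uniformly bounded and converge pointwise. -/
lemma tendsto_fourierMul {ι : Type*} {l : Filter ι} [l.IsCountablyGenerated]
    {f : ι → EuclideanSpace ℝ (Fin d) → ℂ} {g : EuclideanSpace ℝ (Fin d) → ℂ} {C : ℝ}
    (hf : ∀ i, MemLp (f i) ∞ volume) (hg : MemLp g ∞ volume)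
    (hfC : ∀ i ξ, ‖f i ξ‖ ≤ C) (hgC : ∀ ξ, ‖g ξ‖ ≤ C)
    (h : ∀ ξ, Tendsto (fun i => f i ξ) l (𝓝 (g ξ))) (u : L2 d) :
    Tendsto (fun i => fourierMul (f i) (hf i) u) l (𝓝 (fourierMul g hg u)) := by
  rw [tendsto_iff_norm_sub_tendsto_zero]
  have hsq : ∀ i, ‖fourierMul (f i) (hf i) u - fourierMul g hg u‖ ^ 2
      = ∫ ξ, ‖(f i ξ - g ξ) * (𝓕 u : L2 d) ξ‖ ^ 2 := fun i => by
    rw [norm_sq_eq_integral_fourier]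
    refine integral_congr_ae ?_
    filter_upwards [fourier_sub_ae (fourierMul (f i) (hf i) u) (fourierMul g hg u),
      fourier_fourierMul (hf i) u, fourier_fourierMul hg u] with ξ h1 h2 h3
    rw [h1, h2, h3, sub_mul]
  have hu : AEStronglyMeasurable (𝓕 u : L2 d) volume := Lp.aestronglyMeasurable _
  -- By Plancherel this is the squared distance; it is dominated by `(2C)² |û|²`.
  have hlim : Tendsto (fun i => ∫ ξ, ‖(f i ξ - g ξ) * (𝓕 u : L2 d) ξ‖ ^ 2) l
      (𝓝 (∫ _ : EuclideanSpace ℝ (Fin d), (0 : ℝ))) := by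
    refine tendsto_integral_filter_of_dominated_convergence
      (fun ξ => (C + C) ^ 2 * ‖(𝓕 u : L2 d) ξ‖ ^ 2) ?_ ?_ ?_ ?_
    · exact .of_forall fun i => ((((hf i).1.sub hg.1).mul hu).norm.pow 2)
    · refine .of_forall fun i => .of_forall fun ξ => ?_
      rw [Real.norm_of_nonneg (by positivity), norm_mul, mul_pow]
      gcongr
      exact (norm_sub_le _ _).trans (add_le_add (hfC i ξ) (hgC ξ))
    · exact ((Lp.memLp (𝓕 u : L2 d)).integrable_norm_pow two_ne_zero).const_mul _
    · refine .of_forall fun ξ => ?_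
      simpa using ((((h ξ).sub_const (g ξ)).mul_const ((𝓕 u : L2 d) ξ)).norm).pow 2
  simp only [← hsq, integral_zero] at hlim
  have := hlim.sqrt
  simpa using this

end FourierMultiplier

/-! ### The operators `ω⁻¹`, `(-Δ)^{α/2} ω⁻¹` and the group `exp(itω)`. -/

section Symbols

variable {d : ℕ} (α : ℝ)

/-- The symbol `σ(ξ) = (2π|ξ|)^α` of `(-Δ)^{α/2}`. -/
def halfSymbol (ξ : EuclideanSpace ℝ (Fin d)) : ℝ := (2 * Real.pi * ‖ξ‖) ^ (2 * (α / 2))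

/-- The symbol `ω = (1 + σ²)^{1/2}`. -/
def bracketSymbol (ξ : EuclideanSpace ℝ (Fin d)) : ℝ := √(1 + halfSymbol α ξ ^ 2)

lemma fracSymbol_half (ξ : EuclideanSpace ℝ (Fin d)) :
    fracSymbol (α / 2) ξ = (halfSymbol α ξ : ℂ) := rfl

lemma measurable_halfSymbol : Measurable (halfSymbol (d := d) α) := by
  unfold halfSymbol
  fun_prop

lemma measurable_bracketSymbol : Measurable (bracketSymbol (d := d) α) := by
  have := measurable_halfSymbol (d := d) α
  unfold bracketSymbol
  fun_prop

lemma bracketSymbol_sq (ξ : EuclideanSpace ℝ (Fin d)) :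
    bracketSymbol α ξ ^ 2 = 1 + halfSymbol α ξ ^ 2 := Real.sq_sqrt (by positivity)

lemma bracketSymbol_pos (ξ : EuclideanSpace ℝ (Fin d)) : 0 < bracketSymbol α ξ :=
  Real.sqrt_pos.2 (by positivity)

lemma one_le_bracketSymbol (ξ : EuclideanSpace ℝ (Fin d)) : 1 ≤ bracketSymbol α ξ :=
  Real.one_le_sqrt.2 (by nlinarith [sq_nonneg (halfSymbol α ξ)])

lemma abs_halfSymbol_le (ξ : EuclideanSpace ℝ (Fin d)) : |halfSymbol α ξ| ≤ bracketSymbol α ξ :=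
  Real.abs_le_sqrt (by linarith)

lemma memLp_invSymbol :
    MemLp (fun ξ : EuclideanSpace ℝ (Fin d) => (((bracketSymbol α ξ)⁻¹ : ℝ) : ℂ)) ∞ volume := by
  refine memLp_top_of_bound (Complex.measurable_ofReal.comp
    (measurable_bracketSymbol α).inv).aestronglyMeasurable 1 (.of_forall fun ξ => ?_)
  rw [Complex.norm_real, Real.norm_of_nonneg (inv_nonneg.2 (bracketSymbol_pos α ξ).le)]
  exact inv_le_one_of_one_le₀ (one_le_bracketSymbol α ξ)

lemma memLp_ratioSymbol :
    MemLp (fun ξ : EuclideanSpace ℝ (Fin d) =>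
      ((halfSymbol α ξ * (bracketSymbol α ξ)⁻¹ : ℝ) : ℂ)) ∞ volume := by
  refine memLp_top_of_bound (Complex.measurable_ofReal.comp
    ((measurable_halfSymbol α).mul (measurable_bracketSymbol α).inv)).aestronglyMeasurable 1
    (.of_forall fun ξ => ?_)
  rw [Complex.norm_real, Real.norm_eq_abs, abs_mul, abs_inv, abs_of_pos (bracketSymbol_pos α ξ),
    ← div_eq_mul_inv, div_le_one (bracketSymbol_pos α ξ)]
  exact abs_halfSymbol_le α ξ

/-- The symbol `exp (itω)`. -/
def waveSymbol (t : ℝ) (ξ : EuclideanSpace ℝ (Fin d)) : ℂ :=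
  Complex.exp (Complex.I * ((t * bracketSymbol α ξ : ℝ) : ℂ))

lemma norm_waveSymbol (t : ℝ) (ξ : EuclideanSpace ℝ (Fin d)) : ‖waveSymbol α t ξ‖ = 1 :=
  Complex.norm_exp_I_mul_ofReal _

lemma memLp_waveSymbol (t : ℝ) : MemLp (waveSymbol (d := d) α t) ∞ volume := by
  have := measurable_bracketSymbol (d := d) α
  refine memLp_top_of_bound (Measurable.aestronglyMeasurable ?_) 1
    (.of_forall fun ξ => (norm_waveSymbol α t ξ).le)
  unfold waveSymbol
  fun_prop

lemma waveSymbol_mul_neg (t : ℝ) (ξ : EuclideanSpace ℝ (Fin d)) :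
    waveSymbol α t ξ * waveSymbol α (-t) ξ = 1 := by
  rw [waveSymbol, waveSymbol, ← Complex.exp_add]
  simp

lemma hasDerivAt_waveSymbol (t : ℝ) (ξ : EuclideanSpace ℝ (Fin d)) :
    HasDerivAt (fun s => waveSymbol α s ξ)
      (Complex.I * bracketSymbol α ξ * waveSymbol α t ξ) t := by
  have h := (((hasDerivAt_id t).mul_const (bracketSymbol α ξ)).ofReal_comp.const_mul Complex.I).cexp
  refine h.congr_deriv ?_
  simp only [waveSymbol, id, one_mul]
  ring

lemma norm_waveSymbol_sub_le (s t : ℝ) (ξ : EuclideanSpace ℝ (Fin d)) :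
    ‖waveSymbol α s ξ - waveSymbol α t ξ‖ ≤ |s - t| * bracketSymbol α ξ := by
  have h : waveSymbol α s ξ - waveSymbol α t ξ
      = waveSymbol α t ξ * (waveSymbol α (s - t) ξ - 1) := by
    rw [mul_sub, mul_one, waveSymbol, waveSymbol, waveSymbol, ← Complex.exp_add]
    congr 2
    push_cast
    ring
  rw [h, norm_mul, norm_waveSymbol, one_mul]
  refine (Real.norm_exp_I_mul_ofReal_sub_one_le).trans ?_
  rw [Real.norm_eq_abs, abs_mul, abs_of_pos (bracketSymbol_pos α ξ)]

variable (d)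

/-- The operator `(1 + (-Δ)^α)^{-1/2}`. -/
def bessel : L2 d →L[ℂ] L2 d := fourierMul _ (memLp_invSymbol α)

/-- The operator `(-Δ)^{α/2} (1 + (-Δ)^α)^{-1/2}`. -/
def riesz : L2 d →L[ℂ] L2 d := fourierMul _ (memLp_ratioSymbol α)

/-- The unitary group generated by `i (1 + (-Δ)^α)^{1/2}`. -/
def waveGroup (t : ℝ) : L2 d →L[ℂ] L2 d := fourierMul _ (memLp_waveSymbol α t)

variable {d}

lemma fourier_bessel (u : L2 d) : (𝓕 (bessel d α u) : L2 d) =ᵐ[volume]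
    fun ξ => (((bracketSymbol α ξ)⁻¹ : ℝ) : ℂ) * (𝓕 u : L2 d) ξ :=
  fourier_fourierMul _ u

lemma fourier_riesz (u : L2 d) : (𝓕 (riesz d α u) : L2 d) =ᵐ[volume]
    fun ξ => ((halfSymbol α ξ * (bracketSymbol α ξ)⁻¹ : ℝ) : ℂ) * (𝓕 u : L2 d) ξ :=
  fourier_fourierMul _ u

lemma fourier_waveGroup (t : ℝ) (u : L2 d) : (𝓕 (waveGroup d α t u) : L2 d) =ᵐ[volume]
    fun ξ => waveSymbol α t ξ * (𝓕 u : L2 d) ξ :=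
  fourier_fourierMul _ u

lemma inner_bessel_left (u v : L2 d) : (⟪bessel d α u, v⟫ : ℂ) = ⟪u, bessel d α v⟫ :=
  inner_fourierMul_left _ (fun _ => Complex.conj_ofReal _) u v

lemma inner_riesz_left (u v : L2 d) : (⟪riesz d α u, v⟫ : ℂ) = ⟪u, riesz d α v⟫ :=
  inner_fourierMul_left _ (fun _ => Complex.conj_ofReal _) u v

/-- On the Fourier side this is `ω⁻² + σ² ω⁻² = 1`. It turns the form of `H^α` into the inner
product of `L²`. -/
lemma bessel_bessel_add_riesz_riesz (u : L2 d) :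
    bessel d α (bessel d α u) + riesz d α (riesz d α u) = u := by
  refine ext_fourier ?_
  filter_upwards [fourier_add_ae (bessel d α (bessel d α u)) (riesz d α (riesz d α u)),
    fourier_bessel α (bessel d α u),
    fourier_bessel α u,
    fourier_riesz α (riesz d α u),
    fourier_riesz α u] with ξ h1 h2 h3 h4 h5
  rw [h1, h2, h4, h3, h5, ← mul_assoc, ← mul_assoc, ← add_mul]
  have h : (bracketSymbol α ξ)⁻¹ * (bracketSymbol α ξ)⁻¹
      + halfSymbol α ξ * (bracketSymbol α ξ)⁻¹ * (halfSymbol α ξ * (bracketSymbol α ξ)⁻¹) = 1 := by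
    have h0 := (bracketSymbol_pos α ξ).ne'
    field_simp
    exact (bracketSymbol_sq α ξ).symm
  rw [← Complex.ofReal_mul, ← Complex.ofReal_mul, ← Complex.ofReal_add, h, Complex.ofReal_one,
    one_mul]

lemma inner_bessel_add_inner_riesz (u v : L2 d) :
    (⟪bessel d α u, bessel d α v⟫ : ℂ) + ⟪riesz d α u, riesz d α v⟫ = ⟪u, v⟫ := by
  rw [inner_bessel_left, inner_riesz_left, ← inner_add_right, bessel_bessel_add_riesz_riesz]

lemma norm_bessel_sq_add_norm_riesz_sq (u : L2 d) :
    ‖bessel d α u‖ ^ 2 + ‖riesz d α u‖ ^ 2 = ‖u‖ ^ 2 := by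
  have h := inner_bessel_add_inner_riesz α u u
  simp only [inner_self_eq_norm_sq_to_K] at h
  exact_mod_cast h

lemma norm_bessel_le (u : L2 d) : ‖bessel d α u‖ ≤ ‖u‖ :=
  le_of_sq_le_sq (by nlinarith [norm_bessel_sq_add_norm_riesz_sq α u]) (norm_nonneg u)

lemma norm_riesz_le (u : L2 d) : ‖riesz d α u‖ ≤ ‖u‖ :=
  le_of_sq_le_sq (by nlinarith [norm_bessel_sq_add_norm_riesz_sq α u]) (norm_nonneg u)

/-- The difference quotients of `exp(itω)` are bounded only by `ω`. The factor `ω⁻¹` makes them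
bounded by 1, so pointwise convergence of symbols gives strong convergence. -/
lemma hasDerivAt_waveGroup_bessel (u : L2 d) (t : ℝ) :
    HasDerivAt (fun s => waveGroup d α s (bessel d α u)) (Complex.I • waveGroup d α t u) t := by
  -- The symbol of the difference quotient. At `s = t` the convention `0⁻¹ = 0` makes it vanish, so
  -- the bound 1 holds for every `s`.
  let f : ℝ → EuclideanSpace ℝ (Fin d) → ℂ := fun s ξ =>
    (((s - t)⁻¹ : ℝ) : ℂ) * ((waveSymbol α s ξ - waveSymbol α t ξ)
      * (((bracketSymbol α ξ)⁻¹ : ℝ) : ℂ))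
  let g : EuclideanSpace ℝ (Fin d) → ℂ := fun ξ => Complex.I * waveSymbol α t ξ
  have hfC : ∀ s ξ, ‖f s ξ‖ ≤ 1 := fun s ξ => by
    have hpos := bracketSymbol_pos α ξ
    simp only [f, norm_mul, Complex.norm_real, Real.norm_eq_abs, abs_inv, abs_of_pos hpos]
    calc |s - t|⁻¹ * (‖waveSymbol α s ξ - waveSymbol α t ξ‖ * (bracketSymbol α ξ)⁻¹)
        ≤ |s - t|⁻¹ * (|s - t| * bracketSymbol α ξ * (bracketSymbol α ξ)⁻¹) := by
          gcongr; exact norm_waveSymbol_sub_le α s t ξ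
      _ = |s - t|⁻¹ * |s - t| := by rw [mul_assoc |s - t|, mul_inv_cancel₀ hpos.ne', mul_one]
      _ ≤ 1 := inv_mul_le_one
  have hgC : ∀ ξ, ‖g ξ‖ ≤ 1 := fun ξ => by simp [g, norm_waveSymbol]
  have hf : ∀ s, MemLp (f s) ∞ volume := fun s => by
    refine memLp_top_of_bound ?_ 1 (.of_forall (hfC s))
    exact ((((memLp_waveSymbol α s).1.sub (memLp_waveSymbol α t).1).mul
      (memLp_invSymbol α).1).const_mul _)
  have hg : MemLp g ∞ volume :=
    memLp_top_of_bound ((memLp_waveSymbol α t).1.const_mul _) 1 (.of_forall hgC)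
  have hlim : ∀ ξ, Tendsto (fun s => f s ξ) (𝓝[≠] t) (𝓝 (g ξ)) := fun ξ => by
    have h := (hasDerivAt_iff_tendsto_slope.1 (hasDerivAt_waveSymbol α t ξ)).mul_const
      (((bracketSymbol α ξ)⁻¹ : ℝ) : ℂ)
    have h0 : (bracketSymbol α ξ : ℂ) ≠ 0 := by exact_mod_cast (bracketSymbol_pos α ξ).ne'
    have hgξ : g ξ = Complex.I * bracketSymbol α ξ * waveSymbol α t ξ
        * (((bracketSymbol α ξ)⁻¹ : ℝ) : ℂ) := by
      simp only [g]; push_cast; field_simp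
    rw [hgξ]
    refine h.congr fun s => ?_
    simp only [f, slope_def_module, Complex.real_smul]
    ring
  have key := tendsto_fourierMul hf hg hfC hgC hlim u
  rw [hasDerivAt_iff_tendsto_slope]
  have e1 : fourierMul g hg u = Complex.I • waveGroup d α t u := by
    refine ext_fourier ?_
    filter_upwards [fourier_fourierMul hg u, fourier_smul_ae Complex.I (waveGroup d α t u),
      fourier_waveGroup α t u] with ξ h1 h2 h3
    rw [h1, h2, h3, mul_assoc]
  rw [← e1]
  refine key.congr fun s => ext_fourier ?_
  have e2 : slope (fun s => waveGroup d α s (bessel d α u)) t s = (((s - t)⁻¹ : ℝ) : ℂ) •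
      (waveGroup d α s (bessel d α u) - waveGroup d α t (bessel d α u)) := by
    rw [slope_def_module]
    exact (algebraMap_smul ℂ _ _).symm
  rw [e2]
  filter_upwards [fourier_fourierMul (hf s) u,
    fourier_smul_ae (((s - t)⁻¹ : ℝ) : ℂ)
      (waveGroup d α s (bessel d α u) - waveGroup d α t (bessel d α u)),
    fourier_sub_ae (waveGroup d α s (bessel d α u)) (waveGroup d α t (bessel d α u)),
    fourier_waveGroup α s (bessel d α u),
    fourier_waveGroup α t (bessel d α u),
    fourier_bessel α u] with ξ h1 h2 h3 h4 h5 h6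
  rw [h1, h2, h3, h4, h5, h6]
  simp only [f]
  ring

lemma isUnitaryGroup_waveGroup : IsUnitaryGroup (bessel d α) (waveGroup d α) where
  zero u := by
    refine ext_fourier ?_
    filter_upwards [fourier_waveGroup α 0 u] with ξ h
    rw [h]
    simp [waveSymbol]
  inner_map t u v := by
    rw [inner_eq_integral_fourier, inner_eq_integral_fourier]
    refine integral_congr_ae ?_
    filter_upwards [fourier_waveGroup α t u,
      fourier_waveGroup α t v] with ξ h1 h2
    have h : starRingEnd ℂ (waveSymbol α t ξ) * waveSymbol α t ξ = 1 := by
      rw [Complex.conj_mul', norm_waveSymbol]; simp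
    rw [h1, h2]
    simp only [RCLike.inner_apply, map_mul]
    linear_combination ((𝓕 v : L2 d) ξ * starRingEnd ℂ ((𝓕 u : L2 d) ξ)) * h
  apply_neg t u := by
    refine ext_fourier ?_
    filter_upwards [fourier_waveGroup α t (waveGroup d α (-t) u),
      fourier_waveGroup α (-t) u] with ξ h1 h2
    rw [h1, h2, ← mul_assoc, waveSymbol_mul_neg, one_mul]
  comm t u := by
    refine ext_fourier ?_
    filter_upwards [fourier_waveGroup α t (bessel d α u),
      fourier_bessel α (waveGroup d α t u),
      fourier_waveGroup α t u,
      fourier_bessel α u] with ξ h1 h2 h3 h4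
    rw [h2, h3, h1, h4]
    ring
  continuous u := continuous_iff_continuousAt.2 fun t =>
    tendsto_fourierMul (fun s => memLp_waveSymbol α s) (memLp_waveSymbol α t)
      (fun s ξ => (norm_waveSymbol α s ξ).le) (fun ξ => (norm_waveSymbol α t ξ).le)
      (fun ξ => (hasDerivAt_waveSymbol α t ξ).continuousAt) u
  hasDeriv u t := hasDerivAt_waveGroup_bessel α u t

end Symbols

/-! ### The isomorphism `ω : H^α → L²` and its inverse. -/

section Sobolev

variable {d : ℕ} {α : ℝ}

lemma fracFourier_bessel (x : L2 d) :
    fracFourier (α / 2) (bessel d α x) =ᵐ[volume] (𝓕 (riesz d α x) : L2 d) := by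
  filter_upwards [fourier_bessel α x, fourier_riesz α x] with ξ h1 h2
  rw [fracFourier, fracSymbol_half, h1, h2, ← mul_assoc, ← Complex.ofReal_mul]

/-- The element `(1 + (-Δ)^α)^{-1/2} x` of `H^α`. -/
def Hs.ofL2 (x : L2 d) : Hs d α :=
  ⟨bessel d α x, (memLp_congr_ae (fracFourier_bessel x)).2 (Lp.memLp _)⟩

@[simp]
lemma Hs.toL2_ofL2 (x : L2 d) : Hs.toL2 (Hs.ofL2 x : Hs d α) = bessel d α x := rfl

lemma Hs.toL2_injective : Function.Injective (Hs.toL2 : Hs d α → L2 d) :=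
  Subtype.val_injective

lemma Hs.fourier_halfLap (u : Hs d α) :
    (𝓕 (Hs.halfLap u) : L2 d) =ᵐ[volume] fracFourier (α / 2) (Hs.toL2 u) := by
  have h : (𝓕 (Hs.halfLap u) : L2 d)
      = MemLp.toLp (fracFourier (α / 2) (Hs.toL2 u)) (memLp_fracFourier u) :=
    (Lp.fourierTransformₗᵢ (EuclideanSpace ℝ (Fin d)) ℂ).apply_symm_apply _
  rw [h]
  exact MemLp.coeFn_toLp _

@[simp]
lemma Hs.halfLap_ofL2 (x : L2 d) : Hs.halfLap (Hs.ofL2 x : Hs d α) = riesz d α x :=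
  ext_fourier ((Hs.fourier_halfLap _).trans (fracFourier_bessel x))

/-- The operator `(1 + (-Δ)^α)^{1/2} : H^α → L²`. -/
def Hs.lift : Hs d α →ₗ[ℂ] L2 d :=
  (bessel d α).toLinearMap ∘ₗ Hs.toL2 + (riesz d α).toLinearMap ∘ₗ Hs.halfLap

lemma Hs.lift_apply (u : Hs d α) :
    Hs.lift u = bessel d α (Hs.toL2 u) + riesz d α (Hs.halfLap u) := rfl

/-- The symbols multiply to `ω⁻¹ (ω⁻¹ + σ ω⁻¹ σ) = ω⁻² (1 + σ²) = 1`. -/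
lemma Hs.ofL2_lift (u : Hs d α) : Hs.ofL2 (Hs.lift u) = u := by
  refine Hs.toL2_injective (ext_fourier ?_)
  rw [Hs.toL2_ofL2, Hs.lift_apply]
  filter_upwards [fourier_bessel α (bessel d α (Hs.toL2 u) + riesz d α (Hs.halfLap u)),
    fourier_add_ae (bessel d α (Hs.toL2 u)) (riesz d α (Hs.halfLap u)),
    fourier_bessel α (Hs.toL2 u), fourier_riesz α (Hs.halfLap u), Hs.fourier_halfLap u]
    with ξ h1 h2 h3 h4 h5
  rw [h1, h2, h3, h4, h5, fracFourier, fracSymbol_half]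
  have h0 : (bracketSymbol α ξ : ℂ) ≠ 0 := by exact_mod_cast (bracketSymbol_pos α ξ).ne'
  have hsq : (bracketSymbol α ξ : ℂ) ^ 2 = 1 + (halfSymbol α ξ : ℂ) ^ 2 := by
    exact_mod_cast bracketSymbol_sq α ξ
  push_cast
  field_simp
  rw [hsq, mul_comm]

lemma Hs.bessel_lift (u : Hs d α) : bessel d α (Hs.lift u) = Hs.toL2 u :=
  congrArg Hs.toL2 (Hs.ofL2_lift u)

lemma Hs.riesz_lift (u : Hs d α) : riesz d α (Hs.lift u) = Hs.halfLap u := by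
  rw [← Hs.halfLap_ofL2, Hs.ofL2_lift]

lemma Hs.norm_def (u : Hs d α) : ‖u‖ = ‖Hs.toL2 u‖ + ‖Hs.halfLap u‖ := rfl

lemma Hs.continuous_lift : Continuous (Hs.lift : Hs d α → L2 d) := by
  refine AddMonoidHomClass.continuous_of_bound (Hs.lift : Hs d α →ₗ[ℂ] L2 d) 1 fun u => ?_
  rw [one_mul, Hs.norm_def, Hs.lift_apply]
  exact (norm_add_le _ _).trans (add_le_add (norm_bessel_le α _) (norm_riesz_le α _))

lemma Hs.ofL2_sub (x y : L2 d) : (Hs.ofL2 (x - y) : Hs d α) = Hs.ofL2 x - Hs.ofL2 y :=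
  Hs.toL2_injective (by simp)

lemma Hs.continuous_ofL2 : Continuous (Hs.ofL2 : L2 d → Hs d α) := by
  refine continuous_iff_continuousAt.2 fun x => tendsto_iff_norm_sub_tendsto_zero.2 ?_
  have hlim : Tendsto (fun y : L2 d => ‖y - x‖ + ‖y - x‖) (𝓝 x) (𝓝 0) := by
    have h := tendsto_iff_norm_sub_tendsto_zero.1 (tendsto_id (x := 𝓝 x))
    simpa using h.add h
  refine squeeze_zero (fun _ => norm_nonneg _) (fun y => ?_) hlim
  rw [← Hs.ofL2_sub, Hs.norm_def, Hs.toL2_ofL2, Hs.halfLap_ofL2]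
  exact add_le_add (norm_bessel_le α _) (norm_riesz_le α _)

end Sobolev

/-! ### Multiplication by `m` as a bounded symmetric operator. -/

section Potential

variable {d : ℕ}

/-- Multiplication by a bounded real function. -/
def potential (m : LInfty d) : L2 d →L[ℂ] L2 d :=
  LinearMap.mkContinuous
    { toFun := fun u => (m • u : L2 d)
      map_add' := fun u v => Lp.add_smul m u v
      map_smul' := fun c u => by
        refine Lp.ext ?_
        filter_upwards [Lp.coeFn_lpSMul (r := 2) m (c • u), Lp.coeFn_lpSMul (r := 2) m u,
          Lp.coeFn_smul c u, Lp.coeFn_smul c (m • u : L2 d)] with x h1 h2 h3 h4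
        rw [RingHom.id_apply, h1, h4, Pi.smul_apply, Pi.smul_apply', h2, Pi.smul_apply', h3,
          Pi.smul_apply, smul_comm] } ‖m‖ (fun u => Lp.norm_smul_le m u)

lemma potential_apply (m : LInfty d) (u : L2 d) : potential m u = (m • u : L2 d) := rfl

lemma potential_ae (m : LInfty d) (u : L2 d) :
    potential m u =ᵐ[volume] fun x => (m x : ℂ) * u x := by
  filter_upwards [Lp.coeFn_lpSMul (r := 2) m u] with x hx
  rw [potential_apply, hx]
  exact Complex.real_smul

lemma inner_potential_left (m : LInfty d) (u v : L2 d) :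
    (⟪potential m u, v⟫ : ℂ) = ⟪u, potential m v⟫ := by
  rw [L2.inner_def, L2.inner_def]
  refine integral_congr_ae ?_
  filter_upwards [potential_ae m u, potential_ae m v] with x h1 h2
  simp only [h1, h2, RCLike.inner_apply, map_mul, Complex.conj_ofReal]
  ring

lemma re_inner_potential_nonneg {m : LInfty d} (hm : 0 ≤ m) (u : L2 d) :
    0 ≤ (⟪u, potential m u⟫ : ℂ).re := by
  have h : (⟪u, potential m u⟫ : ℂ) = ((∫ x, m x * ‖u x‖ ^ 2 : ℝ) : ℂ) := by
    rw [L2.inner_def, ← integral_complex_ofReal]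
    refine integral_congr_ae ?_
    filter_upwards [potential_ae m u] with x h1
    simp only [h1, RCLike.inner_apply, mul_assoc, Complex.mul_conj']
    push_cast
    rfl
  rw [h, Complex.ofReal_re]
  refine integral_nonneg_of_ae ?_
  filter_upwards [(Lp.coeFn_nonneg m).2 hm] with x hx
  exact mul_nonneg hx (sq_nonneg _)

lemma re_inner_potential_le (m : LInfty d) (u : L2 d) :
    (⟪u, potential m u⟫ : ℂ).re ≤ ‖m‖ * ‖u‖ ^ 2 := by
  refine (Complex.re_le_norm _).trans ((norm_inner_le_norm _ _).trans ?_)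
  have h : ‖potential m u‖ ≤ ‖m‖ * ‖u‖ := Lp.norm_smul_le m u
  nlinarith [norm_nonneg u]

/-- The bounded perturbation `1 - m`. -/
def perturbation (m : LInfty d) : L2 d →L[ℂ] L2 d := ContinuousLinearMap.id ℂ (L2 d) - potential m

lemma perturbation_apply (m : LInfty d) (u : L2 d) : perturbation m u = u - potential m u := rfl

lemma inner_perturbation_left (m : LInfty d) (u v : L2 d) :
    (⟪perturbation m u, v⟫ : ℂ) = ⟪u, perturbation m v⟫ := by
  rw [perturbation_apply, perturbation_apply, inner_sub_left, inner_sub_right,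
    inner_potential_left]

end Potential

/-! ### Passage between the Cauchy problem and the abstract system. -/

section Equivalence

variable {d : ℕ} {α T : ℝ} {m : LInfty d}

/-- With `u = J y` and `φ = J ψ`, add and subtract `⟨φ, u⟩`: the first copy completes the `H^α` form
to `⟨ψ, y⟩`, the second joins the potential as `1 - m`. Every `φ ∈ H^α` arises this way, from `ψ = ω
φ`, so the two weak equations have the same test functions. -/
lemma weakForm_eq (ψ y : L2 d) :
    -((⟪riesz d α ψ, riesz d α y⟫ : ℂ) + ⟪bessel d α ψ, (m • bessel d α y : L2 d)⟫)
      = -⟪ψ, y⟫ + ⟪bessel d α ψ, perturbation m (bessel d α y)⟫ := by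
  rw [← inner_bessel_add_inner_riesz α ψ y, perturbation_apply, inner_sub_right, potential_apply]
  ring

lemma IsWeakSolution.timeDeriv_ofL2 (hT : 0 < T) {y₀ z₀ : L2 d} {y z : ℝ → L2 d}
    (h : IsWeakSolution (bessel d α) (perturbation m) T y₀ z₀ y z) {t : ℝ} (ht : t ∈ Icc 0 T) :
    timeDeriv T (fun s => (Hs.ofL2 (y s) : Hs d α)) t = z t :=
  (h.hasDeriv t ht).derivWithin (uniqueDiffOn_Icc hT t ht)

lemma IsWeakSolution.isSolution (hT : 0 < T) {y₀ z₀ : L2 d} {y z : ℝ → L2 d}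
    (h : IsWeakSolution (bessel d α) (perturbation m) T y₀ z₀ y z) :
    IsSolution T m (Hs.ofL2 y₀ : Hs d α) z₀ (fun t => Hs.ofL2 (y t)) where
  continuousOn := Hs.continuous_ofL2.comp_continuousOn h.continuousOn_fst
  contDiffOn := by
    rw [contDiffOn_one_iff_derivWithin (uniqueDiffOn_Icc hT)]
    exact ⟨fun t ht => (h.hasDeriv t ht).differentiableWithinAt,
      h.continuousOn_snd.congr fun t ht => h.timeDeriv_ofL2 hT ht⟩
  equation φ t ht := by
    have he := h.equation (Hs.lift φ) t ht
    rw [← weakForm_eq, Hs.bessel_lift, Hs.riesz_lift] at he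
    rw [Hs.halfLap_ofL2, Hs.toL2_ofL2]
    exact he.congr (fun s hs => by rw [h.timeDeriv_ofL2 hT hs]) (by rw [h.timeDeriv_ofL2 hT ht])
  initial_value := by rw [h.initial_fst]
  initial_velocity := by rw [h.timeDeriv_ofL2 hT (left_mem_Icc.2 hT.le), h.initial_snd]

lemma IsSolution.isWeakSolution (hT : 0 < T) {u₀ : Hs d α} {u₁ : L2 d} {u : ℝ → Hs d α}
    (h : IsSolution T m u₀ u₁ u) :
    IsWeakSolution (bessel d α) (perturbation m) T (Hs.lift u₀) u₁
      (fun t => Hs.lift (u t)) (timeDeriv T u) where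
  continuousOn_fst := Hs.continuous_lift.comp_continuousOn h.continuousOn
  continuousOn_snd := h.contDiffOn.continuousOn_derivWithin (uniqueDiffOn_Icc hT) le_rfl
  hasDeriv t ht := by
    simp only [Hs.bessel_lift]
    exact (h.contDiffOn.differentiableOn one_ne_zero t ht).hasDerivWithinAt
  equation ψ t ht := by
    have he := h.equation (Hs.ofL2 ψ) t ht
    rw [← Hs.bessel_lift (u t), ← Hs.riesz_lift (u t), Hs.halfLap_ofL2, Hs.toL2_ofL2,
      weakForm_eq] at he
    exact he
  initial_fst := by rw [h.initial_value]
  initial_snd := h.initial_velocity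

lemma IsWeakSolution.sub {H : Type*} [NormedAddCommGroup H] [InnerProductSpace ℂ H]
    [NormedSpace ℝ H] {J B : H →L[ℂ] H} {y₀ z₀ y₀' z₀' : H} {y z y' z' : ℝ → H}
    (h : IsWeakSolution J B T y₀ z₀ y z) (h' : IsWeakSolution J B T y₀' z₀' y' z') :
    IsWeakSolution J B T (y₀ - y₀') (z₀ - z₀') (fun t => y t - y' t) (fun t => z t - z' t) where
  continuousOn_fst := h.continuousOn_fst.sub h'.continuousOn_fst
  continuousOn_snd := h.continuousOn_snd.sub h'.continuousOn_snd
  hasDeriv t ht := by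
    simp only [map_sub]
    exact (h.hasDeriv t ht).sub (h'.hasDeriv t ht)
  equation ψ t ht := by
    simp only [map_sub, inner_sub_right]
    refine ((h.equation ψ t ht).sub (h'.equation ψ t ht)).congr_deriv ?_
    ring
  initial_fst := by rw [h.initial_fst, h'.initial_fst]
  initial_snd := by rw [h.initial_snd, h'.initial_snd]

lemma IsSolution.eqOn (hT : 0 < T) {u₀ : Hs d α} {u₁ : L2 d} {u v : ℝ → Hs d α}
    (hu : IsSolution T m u₀ u₁ u) (hv : IsSolution T m u₀ u₁ v) : EqOn v u (Icc 0 T) := by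
  intro t ht
  have h := (hv.isWeakSolution hT).sub (hu.isWeakSolution hT)
  rw [sub_self, sub_self] at h
  have h0 := h.eq_zero (inner_bessel_left α) t ht
  rw [map_sub, Hs.bessel_lift, Hs.bessel_lift, sub_eq_zero] at h0
  exact Hs.toL2_injective h0

/-- The energy of a solution, read off from the conserved quantity of the weak system. -/
lemma energy_eq (y z : L2 d) :
    ‖z‖ ^ 2 + ‖y‖ ^ 2 - (⟪bessel d α y, perturbation m (bessel d α y)⟫ : ℂ).re
      = ‖z‖ ^ 2 + ‖riesz d α y‖ ^ 2 + (⟪bessel d α y, potential m (bessel d α y)⟫ : ℂ).re := by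
  have h : (⟪bessel d α y, bessel d α y⟫ : ℂ).re = ‖bessel d α y‖ ^ 2 :=
    inner_self_eq_norm_sq (𝕜 := ℂ) _
  rw [perturbation_apply, inner_sub_right, Complex.sub_re, h,
    ← norm_bessel_sq_add_norm_riesz_sq α y]
  ring

end Equivalence

end FractionalKleinGordon

end

/-! ### The energy estimate and the conclusion. -/

theorem lemma2p1 (d : ℕ) (α T : ℝ) (hα : 0 < α) (hT : 0 < T) :
    ∃ C : ℝ, 0 < C ∧
      ∀ m : FractionalKleinGordon.LInfty d, 0 ≤ m →
      ∀ (u₀ : FractionalKleinGordon.Hs d α) (u₁ : FractionalKleinGordon.L2 d),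
      ∃ u : ℝ → FractionalKleinGordon.Hs d α,
        FractionalKleinGordon.IsSolution T m u₀ u₁ u ∧
        (∀ v : ℝ → FractionalKleinGordon.Hs d α,
          FractionalKleinGordon.IsSolution T m u₀ u₁ v → Set.EqOn v u (Set.Icc 0 T)) ∧
        ∀ t ∈ Set.Icc 0 T,
          (‖u t‖ + ‖FractionalKleinGordon.timeDeriv T u t‖) ^ 2
            ≤ C * (1 + ‖m‖) * (‖u₁‖ ^ 2 + ‖u₀‖ ^ 2) := by
  open FractionalKleinGordon in
  -- With `Q` the right-hand side without `C`, both `‖u_t‖` and `‖(-Δ)^{α/2} u‖` are at most `√Q`,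
  -- and `‖u‖` is at most `(1 + T) √Q`.
  refine ⟨(3 + T) ^ 2, by positivity, fun m hm u₀ u₁ => ?_⟩
  obtain ⟨y, z, hyz, hE⟩ := exists_isWeakSolution (isUnitaryGroup_waveGroup α)
    (inner_bessel_left α) (inner_perturbation_left m) hT (Hs.lift u₀) u₁
  have hsol := hyz.isSolution hT
  rw [Hs.ofL2_lift] at hsol
  refine ⟨_, hsol, fun v hv => hsol.eqOn hT hv, fun t ht => ?_⟩
  set Q : ℝ := (1 + ‖m‖) * (‖u₁‖ ^ 2 + ‖u₀‖ ^ 2) with hQ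
  have hQ0 : 0 ≤ Q := by positivity
  have hu₀ : ‖u₀‖ = ‖Hs.toL2 u₀‖ + ‖Hs.halfLap u₀‖ := Hs.norm_def u₀
  -- At time `s` the potential energy is nonnegative and is dropped; at time 0 it is at most `‖m‖
  -- ‖u₀‖²`.
  have hbound : ∀ s ∈ Set.Icc 0 T, ‖z s‖ ^ 2 + ‖riesz d α (y s)‖ ^ 2 ≤ Q := fun s hs => by
    have h := hE s hs
    rw [energy_eq, energy_eq, Hs.riesz_lift, Hs.bessel_lift] at h
    have h1 := re_inner_potential_nonneg hm (bessel d α (y s))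
    have h2 := re_inner_potential_le m (Hs.toL2 u₀)
    have h3 : ‖Hs.toL2 u₀‖ ^ 2 + ‖Hs.halfLap u₀‖ ^ 2 ≤ ‖u₀‖ ^ 2 := by
      rw [hu₀]
      nlinarith [mul_nonneg (norm_nonneg (Hs.toL2 u₀)) (norm_nonneg (Hs.halfLap u₀))]
    have h4 : ‖m‖ * (‖Hs.toL2 u₀‖ ^ 2 + ‖Hs.halfLap u₀‖ ^ 2) ≤ ‖m‖ * ‖u₀‖ ^ 2 :=
      mul_le_mul_of_nonneg_left h3 (norm_nonneg m)
    have h5 : 0 ≤ ‖m‖ * ‖u₁‖ ^ 2 := by positivity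
    have h6 : 0 ≤ ‖m‖ * ‖Hs.halfLap u₀‖ ^ 2 := by positivity
    have h7 := sq_nonneg ‖Hs.toL2 u₀‖
    rw [hQ]
    linarith
  have hz : ∀ s ∈ Set.Icc 0 T, ‖z s‖ ≤ √Q := fun s hs =>
    Real.le_sqrt_of_sq_le (by linarith [hbound s hs, sq_nonneg ‖riesz d α (y s)‖])
  have hr : ‖riesz d α (y t)‖ ≤ √Q :=
    Real.le_sqrt_of_sq_le (by linarith [hbound t ht, sq_nonneg ‖z t‖])
  have h0 : ‖Hs.toL2 u₀‖ ≤ √Q := by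
    refine Real.le_sqrt_of_sq_le ?_
    have h1 : ‖Hs.toL2 u₀‖ ^ 2 ≤ ‖u₀‖ ^ 2 := by
      rw [hu₀]
      gcongr
      linarith [norm_nonneg (Hs.halfLap u₀)]
    have h2 : 0 ≤ ‖m‖ * (‖u₁‖ ^ 2 + ‖u₀‖ ^ 2) := by positivity
    rw [hQ]
    linarith [sq_nonneg ‖u₁‖]
  -- The energy need not control `‖u‖` where `m` vanishes; the mean value inequality with `‖u_t‖ ≤
  -- √Q` does.
  have hb : ‖bessel d α (y t)‖ ≤ √Q + √Q * T := by
    have h := (convex_Icc 0 T).norm_image_sub_le_of_norm_hasDerivWithin_le hyz.hasDeriv hz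
      (Set.left_mem_Icc.2 hT.le) ht
    rw [hyz.initial_fst, Hs.bessel_lift, sub_zero, Real.norm_of_nonneg ht.1] at h
    have h1 := norm_le_norm_add_norm_sub' (bessel d α (y t)) (Hs.toL2 u₀)
    have h2 : √Q * t ≤ √Q * T := mul_le_mul_of_nonneg_left ht.2 (Real.sqrt_nonneg Q)
    linarith
  rw [hyz.timeDeriv_ofL2 hT ht, Hs.norm_def, Hs.toL2_ofL2, Hs.halfLap_ofL2, mul_assoc, ← hQ]
  calc (‖bessel d α (y t)‖ + ‖riesz d α (y t)‖ + ‖z t‖) ^ 2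
      ≤ ((3 + T) * √Q) ^ 2 := by
        gcongr
        linarith [hz t ht]
    _ = (3 + T) ^ 2 * Q := by rw [mul_pow, Real.sq_sqrt hQ0]
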